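/- **Theorem 2 (slow-rate oracle inequality for the time-varying Lasso).** Consider a sequence of models (indexed by $n$; the index is suppressed) with sample size $T$, number of predictors $p_N$, window size $T_0\ge 1$ and target date $t\in\{1,\dots,T\}$, such that $p_N\to\infty$, $T\to\infty$ and $T_0/T\to 0$. For $1\le j\le T$ let $$y_j = x_j'\beta_j^0+\epsilon_j ,\qquad x_j,\beta^0_j\in\mathbb R^{p_N},$$ with deterministic $\beta_j^0$, and suppose, with constants $M,\sigma,C,L,c>0$ that do not depend on $n$: (i) $E(\epsilon_j\mid\mathcal F_{j-1})=0$ and $E(\epsilon_j^2\mid\mathcal F_{j-1})=\sigma^2$, where $\mathcal F_{j-1}=\sigma(x_1,\dots,x_j,\epsilon_1,\dots,\epsilon_{j-1})$; (ii) $E\big(\max_{i\le p_N}|x_{i,j}|^2\big)\le M$ for $1\le j\le T$; (iii) the weights satisfy $0\le w_{tj}\le C$ and $\sum_{j=1}^T w_{tj}\big[1+((j-t)/T_0)^2\big]\le C\,T_0$ (for example $w_{tj}=K((j-t)/T_0)$ with a bounded nonnegative kernel $K$ of compact support); (iv) $\|\beta^0_j-\beta^0_t\|_1\le L\,|j-t|/T$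 for $1\le j\le T$, and $\|\beta_t^0\|_1\ge c$ for all large $n$. Let $\lambda=(\log p_N)^2\,T_0^{-1/2}+T_0/T$ and let $$\hat\beta_t\in\operatorname*{arg\,min}_{\beta\in\mathbb R^{p_N}}\Big\{\frac1{T_0}\sum_{j=1}^T w_{tj}\,(y_j-x_j'\beta)^2+\lambda\|\beta\|_1\Big\}$$ be any minimizer. Then, with probability tending to one, $$\frac1{T_0}\sum_{j=1}^T w_{tj}\big[x_j'(\beta_t^0-\hat\beta_t)\big]^2\le 3\lambda\|\beta_t^0\|_1 .$$ -/

import Mathlib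

open MeasureTheory Filter Topology

namespace TVLasso

/-- The norm `‖b‖₁ = ∑ᵢ |bᵢ|` on `ℝᵖ` (the instance norm on `Fin p → ℝ` is the sup norm). -/
def l1Norm {p : ℕ} (b : Fin p → ℝ) : ℝ := ∑ i, |b i|

/-- The information set `𝓕_{j-1}` generated by `X₁, …, X_j` and `ε₁, …, ε_{j-1}`. -/
@[reducible] def infoSet {Ω : Type*} {p : ℕ} (X : ℕ → Ω → Fin p → ℝ) (ε : ℕ → Ω → ℝ) (j : ℕ) :
    MeasurableSpace Ω :=
  (⨆ s ∈ Finset.Icc 1 j, MeasurableSpace.comap (X s) inferInstance) ⊔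
    (⨆ s ∈ Finset.Ico 1 j, MeasurableSpace.comap (ε s) inferInstance)

/-- `(ε_j)`, `1 ≤ j ≤ T`, is a (conditionally) homoskedastic martingale difference sequence with
variance `σ²`, relative to the information sets generated by the predictors and the past noise. -/
structure IsHomoskedasticMDS {Ω : Type*} [MeasurableSpace Ω] (μ : Measure Ω) {p : ℕ}
    (X : ℕ → Ω → Fin p → ℝ) (ε : ℕ → Ω → ℝ) (T : ℕ) (σ : ℝ) : Prop where
  memLp : ∀ j ∈ Finset.Icc 1 T, MemLp (ε j) 2 μ
  condMean : ∀ j ∈ Finset.Icc 1 T, μ[ε j | infoSet X ε j] =ᵐ[μ] fun _ => 0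
  condVar : ∀ j ∈ Finset.Icc 1 T,
    μ[fun ω => (ε j ω) ^ 2 | infoSet X ε j] =ᵐ[μ] fun _ => σ ^ 2

/-- Nonnegative bounded weights `w_{tj}`, `1 ≤ j ≤ T`, concentrated around `j = t` on the scale
`T₀`: `∑ⱼ w_{tj} (1 + ((j - t)/T₀)²) ≤ C T₀`. Example: `w_{tj} = K((j - t)/T₀)` for a bounded
nonnegative kernel `K` with compact support or Gaussian tails. -/
structure IsLocalWeight (w : ℕ → ℝ) (t T T₀ : ℕ) (C : ℝ) : Prop where
  nonneg : ∀ j ∈ Finset.Icc 1 T, 0 ≤ w j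
  le_const : ∀ j ∈ Finset.Icc 1 T, w j ≤ C
  localized : ∑ j ∈ Finset.Icc 1 T, w j * (1 + (((j : ℝ) - t) / T₀) ^ 2) ≤ C * T₀

/-- The penalty level `λ = (log p)² T₀^{-1/2} + T₀ / T`. -/
noncomputable def penaltyLevel (p T T₀ : ℕ) : ℝ :=
  (Real.log p) ^ 2 / Real.sqrt T₀ + (T₀ : ℝ) / T

/-- `(1/T₀) ∑_{j=1}^T w_j (y_j - x_j' b)² + lam ‖b‖₁`. -/
noncomputable def lassoObjective {p : ℕ} (T T₀ : ℕ) (w y : ℕ → ℝ) (x : ℕ → Fin p → ℝ) (lam : ℝ)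
    (b : Fin p → ℝ) : ℝ :=
  (1 / (T₀ : ℝ)) * ∑ j ∈ Finset.Icc 1 T, w j * (y j - x j ⬝ᵥ b) ^ 2 + lam * l1Norm b

/-- `b` is a (not necessarily unique) minimizer of the Lasso objective over `ℝᵖ`. -/
def IsLasso {p : ℕ} (T T₀ : ℕ) (w y : ℕ → ℝ) (x : ℕ → Fin p → ℝ) (lam : ℝ)
    (b : Fin p → ℝ) : Prop :=
  ∀ b' : Fin p → ℝ, lassoObjective T T₀ w y x lam b ≤ lassoObjective T T₀ w y x lam b'

/-- The weighted in-sample prediction error `(1/T₀) ∑_{j=1}^T w_j [x_j' (β - b)]²`. -/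
noncomputable def predictionError {p : ℕ} (T T₀ : ℕ) (w : ℕ → ℝ) (x : ℕ → Fin p → ℝ)
    (β b : Fin p → ℝ) : ℝ :=
  (1 / (T₀ : ℝ)) * ∑ j ∈ Finset.Icc 1 T, w j * (x j ⬝ᵥ (β - b)) ^ 2

end TVLasso

/-! The proof separates a deterministic inequality from two Markov bounds. Comparing the minimizer
with `β₀ t` reduces the claim (`predictionError_le_of_isLasso`) to two events: the sup norm of the
weighted score is at most `lam / 8`, and the weighted squared bias is at most `lam * l1Norm β / 8`.

Noise: only second moments are available, so no exponential martingale inequality is used. Instead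
`log ∘ partitionFn` serves as a smooth surrogate for the sup norm. Along the score its linear
increment has mean zero, and its quadratic increment is controlled by the conditional variance.
After scaling by `√T₀` the expected sup norm is thus at most `log (2p) + O(1)`
(`integral_norm_score_le`), which is negligible against the threshold `(log p)² / 8`.

Bias: by the Lipschitz condition and localization its mean is `O((T₀/T)²)`, while the threshold is
at least of order `T₀/T`, thanks to the second term of the penalty and to `c ≤ ‖β₀ t‖₁`. -/

namespace TVLasso

/-! ### Log-sum-exp potential for the sup norm -/

/-- A crude form of Hoeffding's lemma for finitely supported probability weights. -/
lemma sum_mul_exp_le {ι : Type*} [Fintype ι] {q s : ι → ℝ} {m : ℝ} (hq : ∀ i, 0 ≤ q i)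
    (hq1 : ∑ i, q i = 1) (hs : ∀ i, |s i| ≤ m) :
    ∑ i, q i * Real.exp (s i) ≤ Real.exp (∑ i, q i * s i + 4 * m ^ 2) := by
  set a := ∑ i, q i * s i with ha
  have ham : |a| ≤ m := by
    calc |a| ≤ ∑ i, |q i * s i| := Finset.abs_sum_le_sum_abs _ _
      _ ≤ ∑ i, q i * m := Finset.sum_le_sum fun i _ => by
          rw [abs_mul, abs_of_nonneg (hq i)]
          exact mul_le_mul_of_nonneg_left (hs i) (hq i)
      _ = m := by rw [← Finset.sum_mul, hq1, one_mul]
  have hsa : ∀ i, |s i - a| ≤ 2 * m := fun i => by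
    have := abs_sub (s i) a
    linarith [hs i]
  have hm : 0 ≤ m := (abs_nonneg _).trans ham
  have key : ∑ i, q i * Real.exp (s i - a) ≤ Real.exp (4 * m ^ 2) := by
    -- Small deviations: `exp u ≤ 1 + u + u²`, and the centred linear term averages to zero. Large
    -- ones: `2m ≤ (2m)²` makes the trivial bound `exp (2m)` sufficient.
    rcases le_or_gt (2 * m) 1 with h | h
    · calc ∑ i, q i * Real.exp (s i - a)
          ≤ ∑ i, (q i * (1 + 4 * m ^ 2) + (q i * s i - q i * a)) :=
            Finset.sum_le_sum fun i _ => by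
              have h1 := Real.abs_exp_sub_one_sub_id_le ((hsa i).trans h)
              have h2 : (s i - a) ^ 2 ≤ (2 * m) ^ 2 := sq_le_sq' (abs_le.1 (hsa i)).1 (abs_le.1 (hsa i)).2
              have h3 : Real.exp (s i - a) ≤ 1 + 4 * m ^ 2 + (s i - a) := by
                linarith [(abs_le.1 h1).2]
              calc _ ≤ q i * (1 + 4 * m ^ 2 + (s i - a)) := mul_le_mul_of_nonneg_left h3 (hq i)
                _ = _ := by ring
        _ = 4 * m ^ 2 + 1 := by
            rw [Finset.sum_add_distrib, Finset.sum_sub_distrib, ← Finset.sum_mul, ← Finset.sum_mul,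
              hq1, ← ha]
            ring
        _ ≤ _ := Real.add_one_le_exp _
    · calc ∑ i, q i * Real.exp (s i - a) ≤ ∑ i, q i * Real.exp (4 * m ^ 2) :=
            Finset.sum_le_sum fun i _ => by
              refine mul_le_mul_of_nonneg_left (Real.exp_le_exp.2 ?_) (hq i)
              nlinarith [(abs_le.1 (hsa i)).2]
        _ = _ := by rw [← Finset.sum_mul, hq1, one_mul]
  calc ∑ i, q i * Real.exp (s i) = Real.exp a * ∑ i, q i * Real.exp (s i - a) := by
        rw [Finset.mul_sum]
        refine Finset.sum_congr rfl fun i _ => ?_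
        rw [Real.exp_sub]
        field_simp
    _ ≤ Real.exp a * Real.exp (4 * m ^ 2) := by gcongr
    _ = _ := (Real.exp_add _ _).symm

/-- Second-order smoothness of the log-sum-exp function. -/
lemma log_sum_exp_add_le {ι : Type*} [Fintype ι] [Nonempty ι] (z s : ι → ℝ) {m : ℝ}
    (hs : ∀ i, |s i| ≤ m) :
    Real.log (∑ i, Real.exp (z i + s i)) ≤ Real.log (∑ i, Real.exp (z i)) +
      ∑ i, Real.exp (z i) / (∑ k, Real.exp (z k)) * s i + 4 * m ^ 2 := by
  set Z := ∑ k, Real.exp (z k) with hZ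
  have hZ0 : 0 < Z := Finset.sum_pos (fun i _ => Real.exp_pos _) Finset.univ_nonempty
  have h := sum_mul_exp_le (q := fun i => Real.exp (z i) / Z) (s := s) (m := m)
    (fun i => by positivity) (by rw [← Finset.sum_div, ← hZ, div_self hZ0.ne']) hs
  have e : ∑ i, Real.exp (z i + s i) = Z * ∑ i, Real.exp (z i) / Z * Real.exp (s i) := by
    rw [Finset.mul_sum]
    refine Finset.sum_congr rfl fun i _ => ?_
    rw [Real.exp_add]
    field_simp
  have hpos : 0 < ∑ i, Real.exp (z i) / Z * Real.exp (s i) :=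
    Finset.sum_pos (fun i _ => by positivity) Finset.univ_nonempty
  rw [e, Real.log_mul hZ0.ne' hpos.ne', add_assoc]
  gcongr
  exact (Real.log_le_iff_le_exp hpos).2 h

/-- The partition function `∑ᵢ (exp zᵢ + exp (-zᵢ))`. -/
noncomputable def partitionFn {p : ℕ} (z : Fin p → ℝ) : ℝ :=
  ∑ i, (Real.exp (z i) + Real.exp (-z i))

/-- The gradient of `log ∘ partitionFn`. -/
noncomputable def gibbsMean {p : ℕ} (z : Fin p → ℝ) (i : Fin p) : ℝ :=
  (Real.exp (z i) - Real.exp (-z i)) / partitionFn z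

lemma exp_add_exp_neg_le_partitionFn {p : ℕ} (z : Fin p → ℝ) (i : Fin p) :
    Real.exp (z i) + Real.exp (-z i) ≤ partitionFn z :=
  Finset.single_le_sum (f := fun i => Real.exp (z i) + Real.exp (-z i))
    (fun i _ => by positivity) (Finset.mem_univ i)

lemma partitionFn_pos {p : ℕ} [NeZero p] (z : Fin p → ℝ) : 0 < partitionFn z :=
  Finset.sum_pos (fun i _ => by positivity) Finset.univ_nonempty

lemma measurable_partitionFn {p : ℕ} : Measurable (partitionFn (p := p)) := by
  unfold partitionFn
  fun_prop

lemma measurable_gibbsMean {p : ℕ} (i : Fin p) :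
    Measurable fun z : Fin p → ℝ => gibbsMean z i := by
  unfold gibbsMean
  exact Measurable.div (by fun_prop) measurable_partitionFn

lemma abs_gibbsMean_le_one {p : ℕ} [NeZero p] (z : Fin p → ℝ) (i : Fin p) :
    |gibbsMean z i| ≤ 1 := by
  have h := exp_add_exp_neg_le_partitionFn z i
  have h0 := partitionFn_pos z
  have h1 := Real.exp_pos (z i)
  have h2 := Real.exp_pos (-z i)
  rw [gibbsMean, abs_div, abs_of_pos h0, div_le_one h0, abs_le]
  constructor <;> linarith

lemma norm_le_log_partitionFn {p : ℕ} [NeZero p] (z : Fin p → ℝ) :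
    ‖z‖ ≤ Real.log (partitionFn z) := by
  refine (pi_norm_le_iff_of_nonempty z).2 fun i => ?_
  have h := exp_add_exp_neg_le_partitionFn z i
  have h0 := partitionFn_pos z
  rw [Real.norm_eq_abs, abs_le', Real.le_log_iff_exp_le h0, Real.le_log_iff_exp_le h0]
  constructor <;> linarith [Real.exp_pos (z i), Real.exp_pos (-z i)]

lemma log_partitionFn_le {p : ℕ} [NeZero p] (z : Fin p → ℝ) :
    Real.log (partitionFn z) ≤ Real.log (2 * p) + ‖z‖ := by
  have hp : (0 : ℝ) < p := by exact_mod_cast Nat.pos_of_ne_zero (NeZero.ne p)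
  rw [Real.log_le_iff_le_exp (partitionFn_pos z), Real.exp_add, Real.exp_log (by positivity)]
  calc partitionFn z ≤ ∑ _i : Fin p, (Real.exp ‖z‖ + Real.exp ‖z‖) := by
        refine Finset.sum_le_sum fun i _ => ?_
        have := abs_le'.1 (norm_le_pi_norm z i)
        gcongr
        exacts [this.1, this.2]
    _ = 2 * p * Real.exp ‖z‖ := by
        simp only [Finset.sum_const, Finset.card_univ, Fintype.card_fin, nsmul_eq_mul]
        ring

/-- Log-sum-exp smoothness applied to the `2p` coordinates `±zᵢ`; the signed pairs recombine into
`gibbsMean`. -/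
lemma log_partitionFn_add_le {p : ℕ} [NeZero p] (z s : Fin p → ℝ) :
    Real.log (partitionFn (z + s)) ≤
      Real.log (partitionFn z) + ∑ i, gibbsMean z i * s i + 4 * ‖s‖ ^ 2 := by
  have h := log_sum_exp_add_le (ι := Fin p ⊕ Fin p) (Sum.elim z (-z)) (Sum.elim s (-s)) (m := ‖s‖)
    (by rintro (i | i)
        · exact norm_le_pi_norm s i
        · simpa using norm_le_pi_norm s i)
  simp only [Fintype.sum_sum_type, Sum.elim_inl, Sum.elim_inr, Pi.neg_apply] at h
  rw [← Finset.sum_add_distrib, ← Finset.sum_add_distrib, ← Finset.sum_add_distrib] at h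
  have e1 : partitionFn (z + s) = ∑ i, (Real.exp (z i + s i) + Real.exp (-z i + -s i)) := by
    simp only [partitionFn, Pi.add_apply, neg_add]
  rw [e1]
  refine h.trans_eq ?_
  simp only [gibbsMean, partitionFn]
  congr 2
  refine Finset.sum_congr rfl fun i _ => ?_
  ring

/-! ### Deterministic basic inequality -/

lemma abs_dotProduct_le {p : ℕ} (x b : Fin p → ℝ) : |x ⬝ᵥ b| ≤ ‖x‖ * l1Norm b := by
  rw [dotProduct, l1Norm, Finset.mul_sum]
  refine (Finset.abs_sum_le_sum_abs _ _).trans (Finset.sum_le_sum fun i _ => ?_)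
  rw [abs_mul]
  exact mul_le_mul_of_nonneg_right (norm_le_pi_norm x i) (abs_nonneg _)

lemma l1Norm_nonneg {p : ℕ} (b : Fin p → ℝ) : 0 ≤ l1Norm b :=
  Finset.sum_nonneg fun _ _ => abs_nonneg _

lemma l1Norm_sub_le {p : ℕ} (a b : Fin p → ℝ) : l1Norm (a - b) ≤ l1Norm a + l1Norm b := by
  simp only [l1Norm, ← Finset.sum_add_distrib]
  exact Finset.sum_le_sum fun i _ => abs_sub (a i) (b i)

/-- The deterministic part of the oracle inequality: `e` is the noise, `r` the bias. -/
lemma predictionError_le_of_isLasso {p T T₀ : ℕ} {w y e r : ℕ → ℝ} {x : ℕ → Fin p → ℝ}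
    {lam : ℝ} {β b : Fin p → ℝ} (hw : ∀ j ∈ Finset.Icc 1 T, 0 ≤ w j)
    (hy : ∀ j ∈ Finset.Icc 1 T, y j = x j ⬝ᵥ β + r j + e j)
    (hlam : 0 ≤ lam) (hb : IsLasso T T₀ w y x lam b)
    (hnoise : ‖(1 / (T₀ : ℝ)) • ∑ j ∈ Finset.Icc 1 T, (w j * e j) • x j‖ ≤ lam / 8)
    (hbias : (1 / (T₀ : ℝ)) * ∑ j ∈ Finset.Icc 1 T, w j * r j ^ 2 ≤ lam * l1Norm β / 8) :
    predictionError T T₀ w x β b ≤ 3 * lam * l1Norm β := by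
  set z := (1 / (T₀ : ℝ)) • ∑ j ∈ Finset.Icc 1 T, (w j * e j) • x j with hz
  have hmin := hb β
  have hzd : |z ⬝ᵥ (b - β)| ≤ lam / 8 * (l1Norm b + l1Norm β) :=
    (abs_dotProduct_le _ _).trans (mul_le_mul hnoise (l1Norm_sub_le _ _) (l1Norm_nonneg _)
      (by positivity))
  have hze : z ⬝ᵥ (b - β) =
      (1 / (T₀ : ℝ)) * ∑ j ∈ Finset.Icc 1 T, w j * e j * (x j ⬝ᵥ (b - β)) := by
    rw [hz, smul_dotProduct, sum_dotProduct, smul_eq_mul]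
    simp only [smul_dotProduct, smul_eq_mul]
  have hsum : (1 / (T₀ : ℝ)) * ∑ j ∈ Finset.Icc 1 T,
        (w j * (y j - x j ⬝ᵥ β) ^ 2 + w j * (x j ⬝ᵥ (β - b)) ^ 2 / 2
          - 2 * (w j * r j ^ 2) - 2 * (w j * e j * (x j ⬝ᵥ (b - β)))) ≤
      (1 / (T₀ : ℝ)) * ∑ j ∈ Finset.Icc 1 T, w j * (y j - x j ⬝ᵥ b) ^ 2 := by
    refine mul_le_mul_of_nonneg_left (Finset.sum_le_sum fun j hj => ?_) (by positivity)
    rw [hy j hj, dotProduct_sub, dotProduct_sub]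
    -- With `u = xⱼ'(b - β)`, the bias cross term is absorbed by `u² - 2ru ≥ u²/2 - 2r²`, which is
    -- `(2r - u)² ≥ 0`.
    nlinarith [mul_nonneg (hw j hj) (sq_nonneg (2 * r j - (x j ⬝ᵥ b - x j ⬝ᵥ β)))]
  rw [Finset.sum_sub_distrib, Finset.sum_sub_distrib, Finset.sum_add_distrib, ← Finset.sum_div,
    ← Finset.mul_sum, ← Finset.mul_sum] at hsum
  unfold lassoObjective at hmin
  unfold predictionError
  -- Half the prediction error is at most `lam (1/4 + 1/4 + 1) ‖β‖₁ - (3/4) lam ‖b‖₁`; dropping the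
  -- last term and doubling gives the factor 3.
  have hlb : 0 ≤ lam * l1Norm b := mul_nonneg hlam (l1Norm_nonneg b)
  have := (abs_le.1 hzd).2
  rw [hze] at this
  nlinarith

/-! ### Conditional moments of one score increment -/

/-- If `E(e² | m) = σ²`, then `E(f e²) = σ² E f` for every nonnegative `m`-measurable `f`. -/
lemma lintegral_mul_sq_eq_of_condExp_sq {Ω : Type*} {m m0 : MeasurableSpace Ω} {μ : Measure Ω}
    [IsFiniteMeasure μ] (hm : m ≤ m0) {e : Ω → ℝ} (hem : Measurable e) (he : MemLp e 2 μ)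
    {σ : ℝ} (hσ : μ[fun ω => e ω ^ 2 | m] =ᵐ[μ] fun _ => σ ^ 2)
    {f : Ω → ENNReal} (hf : Measurable[m] f) :
    ∫⁻ ω, ENNReal.ofReal (e ω ^ 2) * f ω ∂μ = ENNReal.ofReal (σ ^ 2) * ∫⁻ ω, f ω ∂μ := by
  set ν := μ.withDensity fun ω => ENNReal.ofReal (e ω ^ 2) with hν
  have hmeas : Measurable fun ω => ENNReal.ofReal (e ω ^ 2) := (hem.pow_const 2).ennreal_ofReal
  have hint : Integrable (fun ω => e ω ^ 2) μ := he.integrable_sq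
  -- The conditional variance says that the measure with density `e²` agrees with `σ² μ` on
  -- `m`-measurable sets.
  have htrim : ν.trim hm = ENNReal.ofReal (σ ^ 2) • μ.trim hm := by
    refine @Measure.ext _ m _ _ fun A hA => ?_
    rw [trim_measurableSet_eq hm hA, Measure.smul_apply, trim_measurableSet_eq hm hA, hν,
      withDensity_apply _ (hm A hA),
      ← ofReal_integral_eq_lintegral_ofReal hint.integrableOn (ae_of_all _ fun _ => sq_nonneg _),
      ← setIntegral_condExp hm hint hA, setIntegral_congr_ae (hm A hA) (hσ.mono fun _ h _ => h),
      setIntegral_const, smul_eq_mul, smul_eq_mul, mul_comm,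
      ENNReal.ofReal_mul (sq_nonneg _), ofReal_measureReal]
  have h1 := lintegral_withDensity_eq_lintegral_mul μ hmeas (hf.mono hm le_rfl)
  simp only [Pi.mul_apply] at h1
  rw [← h1, ← hν, ← lintegral_trim hm hf, htrim, lintegral_smul_measure, lintegral_trim hm hf,
    smul_eq_mul]

lemma integrable_score_summand {Ω : Type*} [MeasurableSpace Ω] {μ : Measure Ω} {p : ℕ} [IsFiniteMeasure μ] {e : Ω → ℝ} {x : Ω → Fin p → ℝ}
    (he : MemLp e 2 μ) (hx : MemLp x 2 μ) (a : ℝ) :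
    Integrable (fun ω => (a * e ω) • x ω) μ :=
  memLp_one_iff_integrable.1 (hx.smul (he.const_mul a))

/-- The Gibbs weight and `x` are both `m`-measurable, so they pull out of the conditional
expectation of `e`, which vanishes. Boundedness of the weight supplies integrability. -/
lemma integral_gibbsMean_mul_eq_zero {Ω : Type*} {m m0 : MeasurableSpace Ω} {μ : Measure Ω}
    {p : ℕ} [NeZero p] [IsFiniteMeasure μ]
    (hm : m ≤ m0) {e : Ω → ℝ} {x S : Ω → Fin p → ℝ} (he : MemLp e 2 μ) (hx : MemLp x 2 μ)
    (hxm : Measurable[m] x) (hS : Measurable[m] S) (he0 : μ[e | m] =ᵐ[μ] fun _ => 0) (a : ℝ)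
    (i : Fin p) :
    Integrable (fun ω => gibbsMean (S ω) i * ((a * e ω) • x ω) i) μ ∧
      ∫ ω, gibbsMean (S ω) i * ((a * e ω) • x ω) i ∂μ = 0 := by
  have hg : Measurable[m] fun ω => gibbsMean (S ω) i := (measurable_gibbsMean i).comp hS
  have hxi : Measurable[m] fun ω => x ω i := (measurable_pi_apply i).comp hxm
  have hint : Integrable (fun ω => gibbsMean (S ω) i * ((a * e ω) • x ω) i) μ := by
    refine ((integrable_score_summand he hx a).eval i).bdd_mul (c := 1)
      (hg.mono hm le_rfl).aestronglyMeasurable (ae_of_all _ fun ω => ?_)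
    exact abs_gibbsMean_le_one _ _
  refine ⟨hint, ?_⟩
  have heq : (fun ω => gibbsMean (S ω) i * ((a * e ω) • x ω) i) =
      (fun ω => gibbsMean (S ω) i * (a * x ω i)) * e := by
    ext ω
    simp only [Pi.smul_apply, smul_eq_mul, Pi.mul_apply]
    ring
  rw [heq] at hint ⊢
  have hpull := condExp_mul_of_stronglyMeasurable_left (m := m)
    (f := fun ω => gibbsMean (S ω) i * (a * x ω i))
    (Measurable.stronglyMeasurable (hg.mul (hxi.const_mul a))) hint (he.integrable (by norm_num))
  rw [← integral_condExp hm, integral_congr_ae hpull]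
  refine integral_eq_zero_of_ae ?_
  filter_upwards [he0] with ω hω
  simp [hω]

/-- A product of two square-integrable functions need not be square-integrable; constancy of the
conditional variance makes it so here, via the extended-valued identity. -/
lemma integral_sq_norm_smul_eq {Ω : Type*} {m m0 : MeasurableSpace Ω} {μ : Measure Ω}
    {p : ℕ} [IsFiniteMeasure μ]
    (hm : m ≤ m0) {e : Ω → ℝ} {x : Ω → Fin p → ℝ} (hem : Measurable e) (he : MemLp e 2 μ)
    (hx : MemLp x 2 μ) (hxm : Measurable[m] x) {σ : ℝ}
    (hσ : μ[fun ω => e ω ^ 2 | m] =ᵐ[μ] fun _ => σ ^ 2) (a : ℝ) :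
    Integrable (fun ω => ‖(a * e ω) • x ω‖ ^ 2) μ ∧
      ∫ ω, ‖(a * e ω) • x ω‖ ^ 2 ∂μ = a ^ 2 * (σ ^ 2 * ∫ ω, ‖x ω‖ ^ 2 ∂μ) := by
  have hxm' : Measurable x := hxm.mono hm le_rfl
  have hx2 : Integrable (fun ω => ‖x ω‖ ^ 2) μ := hx.integrable_norm_pow two_ne_zero
  have hl := lintegral_mul_sq_eq_of_condExp_sq hm hem he hσ
    (f := fun ω => ENNReal.ofReal (‖x ω‖ ^ 2)) ((measurable_norm.comp hxm).pow_const 2).ennreal_ofReal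
  simp only [← ENNReal.ofReal_mul (sq_nonneg _)] at hl
  rw [← ofReal_integral_eq_lintegral_ofReal hx2 (ae_of_all _ fun _ => sq_nonneg _),
    ← ENNReal.ofReal_mul (sq_nonneg _)] at hl
  have hmeas : Measurable fun ω => e ω ^ 2 * ‖x ω‖ ^ 2 :=
    (hem.pow_const 2).mul (hxm'.norm.pow_const 2)
  have hnn : 0 ≤ᵐ[μ] fun ω => e ω ^ 2 * ‖x ω‖ ^ 2 := ae_of_all _ fun _ => by positivity
  have hint : Integrable (fun ω => e ω ^ 2 * ‖x ω‖ ^ 2) μ := by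
    refine (lintegral_ofReal_ne_top_iff_integrable hmeas.aestronglyMeasurable hnn).1 ?_
    rw [hl]
    exact ENNReal.ofReal_ne_top
  have hval : ∫ ω, e ω ^ 2 * ‖x ω‖ ^ 2 ∂μ = σ ^ 2 * ∫ ω, ‖x ω‖ ^ 2 ∂μ := by
    rw [integral_eq_lintegral_of_nonneg_ae hnn hmeas.aestronglyMeasurable, hl,
      ENNReal.toReal_ofReal (by positivity)]
  have heq : (fun ω => ‖(a * e ω) • x ω‖ ^ 2) = fun ω => a ^ 2 * (e ω ^ 2 * ‖x ω‖ ^ 2) := by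
    ext ω
    rw [norm_smul, Real.norm_eq_abs, mul_pow, sq_abs]
    ring
  rw [heq, integral_const_mul, hval]
  exact ⟨hint.const_mul _, rfl⟩

/-! ### Maximal inequality for the score -/

section Martingale

variable {Ω : Type*} {p T : ℕ}
  {X : ℕ → Ω → Fin p → ℝ} {ε : ℕ → Ω → ℝ}

lemma measurable_infoSet_predictor {j k : ℕ} (hk : k ∈ Finset.Icc 1 j) :
    Measurable[infoSet X ε j] (X k) := by
  rw [measurable_iff_comap_le]
  exact le_sup_of_le_left (le_iSup₂_of_le k hk le_rfl)

lemma measurable_infoSet_noise {j k : ℕ} (hk : k ∈ Finset.Ico 1 j) :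
    Measurable[infoSet X ε j] (ε k) := by
  rw [measurable_iff_comap_le]
  exact le_sup_of_le_right (le_iSup₂_of_le k hk le_rfl)

/-- The score process `∑_{k ≤ j} aₖ εₖ xₖ`. -/
def score (a : ℕ → ℝ) (X : ℕ → Ω → Fin p → ℝ) (ε : ℕ → Ω → ℝ) (j : ℕ) (ω : Ω) : Fin p → ℝ :=
  ∑ k ∈ Finset.Icc 1 j, (a k * ε k ω) • X k ω

lemma score_succ (a : ℕ → ℝ) (j : ℕ) (ω : Ω) :
    score a X ε (j + 1) ω =
      score a X ε j ω + (a (j + 1) * ε (j + 1) ω) • X (j + 1) ω := by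
  rw [score, score, Finset.sum_Icc_succ_top (by omega)]

/-- The information set at `j + 1` contains the noise only up to `j`, so the current score is
predictable for the next increment. -/
lemma measurable_infoSet_score (a : ℕ → ℝ) (j : ℕ) :
    Measurable[infoSet X ε (j + 1)] (score a X ε j) := by
  unfold score
  refine Finset.measurable_fun_sum _ fun k hk => ?_
  rw [Finset.mem_Icc] at hk
  exact ((measurable_infoSet_noise (Finset.mem_Ico.2 ⟨hk.1, by omega⟩)).const_mul (a k)).smul
    (measurable_infoSet_predictor (Finset.mem_Icc.2 ⟨hk.1, by omega⟩))

variable [m0 : MeasurableSpace Ω] {μ : Measure Ω}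

lemma infoSet_le (hXm : ∀ j ∈ Finset.Icc 1 T, Measurable (X j))
    (hεm : ∀ j ∈ Finset.Icc 1 T, Measurable (ε j)) {j : ℕ} (hj : j ∈ Finset.Icc 1 T) :
    infoSet X ε j ≤ m0 := by
  rw [Finset.mem_Icc] at hj
  refine sup_le (iSup₂_le fun k hk => ?_) (iSup₂_le fun k hk => ?_)
  · rw [Finset.mem_Icc] at hk
    exact (hXm k (Finset.mem_Icc.2 ⟨hk.1, hk.2.trans hj.2⟩)).comap_le
  · rw [Finset.mem_Ico] at hk
    exact (hεm k (Finset.mem_Icc.2 ⟨hk.1, hk.2.le.trans hj.2⟩)).comap_le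

lemma integrable_score [IsFiniteMeasure μ] {σ : ℝ} (hε : IsHomoskedasticMDS μ X ε T σ)
    (hX : ∀ j ∈ Finset.Icc 1 T, MemLp (X j) 2 μ) (a : ℕ → ℝ) {j : ℕ} (hj : j ≤ T) :
    Integrable (score a X ε j) μ := by
  unfold score
  refine integrable_finsetSum _ fun k hk => ?_
  have hk' : k ∈ Finset.Icc 1 T := by
    rw [Finset.mem_Icc] at hk ⊢
    omega
  exact integrable_score_summand (hε.memLp k hk') (hX k hk') (a k)

lemma integrable_log_partitionFn [NeZero p] [IsFiniteMeasure μ] {S : Ω → Fin p → ℝ}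
    (hS : Integrable S μ) : Integrable (fun ω => Real.log (partitionFn (S ω))) μ := by
  refine Integrable.mono' ((integrable_const (Real.log (2 * p))).add hS.norm)
    (Real.measurable_log.comp measurable_partitionFn
      |>.comp_aemeasurable hS.aemeasurable).aestronglyMeasurable (ae_of_all _ fun ω => ?_)
  rw [Real.norm_eq_abs, abs_of_nonneg ((norm_nonneg _).trans (norm_le_log_partitionFn _))]
  exact log_partitionFn_le _

/-- A maximal inequality for the score process, by the log-sum-exp potential method. -/
lemma integral_norm_score_le [NeZero p] [IsProbabilityMeasure μ] {σ M : ℝ}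
    (hXm : ∀ j ∈ Finset.Icc 1 T, Measurable (X j))
    (hεm : ∀ j ∈ Finset.Icc 1 T, Measurable (ε j))
    (hε : IsHomoskedasticMDS μ X ε T σ)
    (hX : ∀ j ∈ Finset.Icc 1 T, MemLp (X j) 2 μ ∧ ∫ ω, ‖X j ω‖ ^ 2 ∂μ ≤ M) (a : ℕ → ℝ) :
    ∫ ω, ‖score a X ε T ω‖ ∂μ ≤
      Real.log (2 * p) + 4 * (σ ^ 2 * M) * ∑ j ∈ Finset.Icc 1 T, a j ^ 2 := by
  have hSint : ∀ j ≤ T, Integrable (score a X ε j) μ := fun j hj =>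
    integrable_score hε (fun j hj => (hX j hj).1) a hj
  have key : ∀ j ≤ T, ∫ ω, Real.log (partitionFn (score a X ε j ω)) ∂μ ≤
      Real.log (2 * p) + 4 * (σ ^ 2 * M) * ∑ k ∈ Finset.Icc 1 j, a k ^ 2 := by
    intro j
    induction j with
    | zero =>
      intro _
      have h := log_partitionFn_le (0 : Fin p → ℝ)
      simpa [score] using h
    | succ j ih =>
      intro hj
      have hjT : j + 1 ∈ Finset.Icc 1 T := Finset.mem_Icc.2 ⟨by omega, hj⟩
      have hm := infoSet_le hXm hεm hjT
      have hxm : Measurable[infoSet X ε (j + 1)] (X (j + 1)) :=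
        measurable_infoSet_predictor (Finset.mem_Icc.2 ⟨by omega, le_rfl⟩)
      have hlin := integral_gibbsMean_mul_eq_zero hm (hε.memLp _ hjT) (hX _ hjT).1 hxm
        (measurable_infoSet_score a j) (hε.condMean _ hjT) (a (j + 1))
      have hquad := integral_sq_norm_smul_eq hm (hεm _ hjT) (hε.memLp _ hjT) (hX _ hjT).1 hxm
        (hε.condVar _ hjT) (a (j + 1))
      have hΦ := integrable_log_partitionFn (hSint j (by omega))
      have hsumint := integrable_finsetSum Finset.univ fun i _ => (hlin i).1
      have hfirst : Integrable (fun ω => Real.log (partitionFn (score a X ε j ω)) +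
          ∑ i, gibbsMean (score a X ε j ω) i * ((a (j + 1) * ε (j + 1) ω) • X (j + 1) ω) i) μ :=
        hΦ.add hsumint
      calc ∫ ω, Real.log (partitionFn (score a X ε (j + 1) ω)) ∂μ
          ≤ ∫ ω, (Real.log (partitionFn (score a X ε j ω)) +
              ∑ i, gibbsMean (score a X ε j ω) i *
                ((a (j + 1) * ε (j + 1) ω) • X (j + 1) ω) i +
              4 * ‖(a (j + 1) * ε (j + 1) ω) • X (j + 1) ω‖ ^ 2) ∂μ := by
            refine integral_mono (integrable_log_partitionFn (hSint _ hj))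
              (hfirst.add (hquad.1.const_mul 4)) fun ω => ?_
            simp only [score_succ]
            exact log_partitionFn_add_le _ _
        _ = ∫ ω, Real.log (partitionFn (score a X ε j ω)) ∂μ +
              4 * (a (j + 1) ^ 2 * (σ ^ 2 * ∫ ω, ‖X (j + 1) ω‖ ^ 2 ∂μ)) := by
            rw [integral_add hfirst (hquad.1.const_mul 4), integral_add hΦ hsumint,
              integral_finsetSum _ fun i _ => (hlin i).1, integral_const_mul, hquad.2,
              Finset.sum_eq_zero fun i _ => (hlin i).2, add_zero]
        _ ≤ _ := by
            rw [Finset.sum_Icc_succ_top (by omega)]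
            have h1 := ih (by omega)
            have h2 : a (j + 1) ^ 2 * (σ ^ 2 * ∫ ω, ‖X (j + 1) ω‖ ^ 2 ∂μ) ≤
                a (j + 1) ^ 2 * (σ ^ 2 * M) := by
              gcongr
              exact (hX _ hjT).2
            linarith
  refine (integral_mono (hSint T le_rfl).norm (integrable_log_partitionFn (hSint T le_rfl))
    fun ω => ?_).trans (key T le_rfl)
  exact norm_le_log_partitionFn _

end Martingale

/-! ### Sums of the localized weights -/

lemma IsLocalWeight.const_nonneg {w : ℕ → ℝ} {t T T₀ : ℕ} {C : ℝ}
    (hw : IsLocalWeight w t T T₀ C) (hT₀ : 1 ≤ T₀) : 0 ≤ C := by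
  have h0 : (0 : ℝ) < T₀ := by exact_mod_cast hT₀
  have h : 0 ≤ C * T₀ := le_trans
    (Finset.sum_nonneg fun j hj => mul_nonneg (hw.nonneg j hj) (by positivity)) hw.localized
  exact nonneg_of_mul_nonneg_left h h0

lemma IsLocalWeight.sum_sq_le {w : ℕ → ℝ} {t T T₀ : ℕ} {C : ℝ}
    (hw : IsLocalWeight w t T T₀ C) (hT₀ : 1 ≤ T₀) :
    ∑ j ∈ Finset.Icc 1 T, w j ^ 2 ≤ C ^ 2 * T₀ := by
  have hC := hw.const_nonneg hT₀
  calc ∑ j ∈ Finset.Icc 1 T, w j ^ 2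
      ≤ ∑ j ∈ Finset.Icc 1 T, C * (w j * (1 + (((j : ℝ) - t) / T₀) ^ 2)) :=
        Finset.sum_le_sum fun j hj => by
          have h0 := hw.nonneg j hj
          have h1 := mul_nonneg (mul_nonneg hC h0) (sq_nonneg (((j : ℝ) - t) / T₀))
          have h2 := mul_le_mul_of_nonneg_right (hw.le_const j hj) h0
          linarith
    _ ≤ C * (C * T₀) := by
        rw [← Finset.mul_sum]
        exact mul_le_mul_of_nonneg_left hw.localized hC
    _ = _ := by ring

/-- Rescaling time from `T` to `T₀` extracts `(T₀/T)²`; the second-moment part of `localized` bounds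
the rest. -/
lemma IsLocalWeight.sum_mul_sq_le {w : ℕ → ℝ} {t T T₀ : ℕ} {C : ℝ}
    (hw : IsLocalWeight w t T T₀ C) (hT₀ : 1 ≤ T₀) :
    (1 / (T₀ : ℝ)) * ∑ j ∈ Finset.Icc 1 T, w j * (((j : ℝ) - t) / T) ^ 2 ≤
      C * ((T₀ : ℝ) / T) ^ 2 := by
  have h0 : (0 : ℝ) < T₀ := by exact_mod_cast hT₀
  have h : ∑ j ∈ Finset.Icc 1 T, w j * (((j : ℝ) - t) / T) ^ 2 ≤
      ((T₀ : ℝ) / T) ^ 2 * (C * T₀) := by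
    refine le_trans ?_ (mul_le_mul_of_nonneg_left hw.localized (sq_nonneg _))
    rw [Finset.mul_sum]
    refine Finset.sum_le_sum fun j hj => ?_
    have e : (((j : ℝ) - t) / T) ^ 2 = ((T₀ : ℝ) / T) ^ 2 * (((j : ℝ) - t) / T₀) ^ 2 := by
      rw [← mul_pow]
      congr 1
      field_simp
    rw [e]
    nlinarith [mul_nonneg (sq_nonneg ((T₀ : ℝ) / T)) (hw.nonneg j hj)]
  calc _ ≤ (1 / (T₀ : ℝ)) * (((T₀ : ℝ) / T) ^ 2 * (C * T₀)) := by gcongr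
    _ = _ := by field_simp

/-! ### Probability bounds and the limit -/

/-- Markov's inequality in the form `P(f ≥ b) ≤ B / b` for `E f ≤ B`. -/
lemma measure_ge_le_of_integral_le {Ω : Type*} [MeasurableSpace Ω] {μ : Measure Ω}
    [IsFiniteMeasure μ] {f : Ω → ℝ} (hf : Integrable f μ) (hf0 : ∀ ω, 0 ≤ f ω) {b B : ℝ}
    (hb : 0 < b) (hB : ∫ ω, f ω ∂μ ≤ B) : μ {ω | b ≤ f ω} ≤ ENNReal.ofReal (B / b) := by
  have h := (mul_meas_ge_le_integral_of_nonneg (ae_of_all _ hf0) hf b).trans hB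
  rw [← ofReal_measureReal]
  refine ENNReal.ofReal_le_ofReal ?_
  rw [le_div_iff₀ hb]
  linarith

/-- The non-asymptotic oracle inequality: explicit bound on the exceptional probability. -/
lemma measure_predictionError_gt_le {Ω : Type*} [MeasurableSpace Ω] {μ : Measure Ω}
    [IsProbabilityMeasure μ] {p T T₀ t : ℕ} (hp : 2 ≤ p) (hT₀ : 1 ≤ T₀)
    (ht : t ∈ Finset.Icc 1 T) {w : ℕ → ℝ} {C : ℝ} (hw : IsLocalWeight w t T T₀ C)
    {X : ℕ → Ω → Fin p → ℝ} {ε y : ℕ → Ω → ℝ}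
    (hXm : ∀ j ∈ Finset.Icc 1 T, Measurable (X j))
    (hεm : ∀ j ∈ Finset.Icc 1 T, Measurable (ε j)) {M : ℝ}
    (hX : ∀ j ∈ Finset.Icc 1 T, MemLp (X j) 2 μ ∧ ∫ ω, ‖X j ω‖ ^ 2 ∂μ ≤ M) {σ : ℝ}
    (hε : IsHomoskedasticMDS μ X ε T σ) {β₀ : ℕ → Fin p → ℝ} {L : ℝ}
    (hβ₀ : ∀ j ∈ Finset.Icc 1 T,
      l1Norm (β₀ j - β₀ t) ≤ L * (|(j : ℝ) - (t : ℝ)| / (T : ℝ)))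
    {c : ℝ} (hc : 0 < c) (hβ₀c : c ≤ l1Norm (β₀ t))
    (hy : ∀ j ∈ Finset.Icc 1 T, ∀ ω, y j ω = X j ω ⬝ᵥ β₀ j + ε j ω)
    {βhat : Ω → Fin p → ℝ}
    (hβhat : ∀ᵐ ω ∂μ, IsLasso T T₀ w (fun j => y j ω) (fun j => X j ω)
      (penaltyLevel p T T₀) (βhat ω)) :
    μ {ω | ¬ predictionError T T₀ w (fun j => X j ω) (β₀ t) (βhat ω)
        ≤ 3 * penaltyLevel p T T₀ * l1Norm (β₀ t)} ≤
      ENNReal.ofReal ((Real.log (2 * p) + 4 * (σ ^ 2 * M) * C ^ 2) / (Real.log p ^ 2 / 8)) +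
        ENNReal.ofReal (8 * (M * L ^ 2 * C) / c * ((T₀ : ℝ) / T)) := by
  have : NeZero p := ⟨by omega⟩
  have hT₀' : (0 : ℝ) < T₀ := by exact_mod_cast hT₀
  have hT' : (0 : ℝ) < T := by
    rw [Finset.mem_Icc] at ht
    exact_mod_cast (by omega : 0 < T)
  have hM : 0 ≤ M := le_trans (integral_nonneg fun _ => sq_nonneg _) (hX t ht).2
  have hlog : 0 < Real.log p := Real.log_pos (by exact_mod_cast (by omega : 1 < p))
  have hlam : 0 ≤ penaltyLevel p T T₀ := by
    unfold penaltyLevel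
    positivity
  set s := Real.sqrt T₀ with hs
  have hs0 : 0 < s := Real.sqrt_pos.2 hT₀'
  have hss : s ^ 2 = T₀ := Real.sq_sqrt hT₀'.le
  -- This scaling balances the maximal inequality: the squared weights sum to at most `C²`, and the
  -- remaining factor `1 / s` turns the threshold `(log p)² / 8` into an eighth of the first term of
  -- the penalty.
  set a : ℕ → ℝ := fun j => w j / s with ha
  -- the noise
  have ha2 : ∑ j ∈ Finset.Icc 1 T, a j ^ 2 ≤ C ^ 2 := by
    simp only [ha, div_pow, hss]
    rw [← Finset.sum_div, div_le_iff₀ hT₀']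
    exact hw.sum_sq_le hT₀
  have hmax : ∫ ω, ‖score a X ε T ω‖ ∂μ ≤ Real.log (2 * p) + 4 * (σ ^ 2 * M) * C ^ 2 := by
    refine (integral_norm_score_le hXm hεm hε hX a).trans ?_
    gcongr
  have hnoise := measure_ge_le_of_integral_le (b := Real.log p ^ 2 / 8)
    (integrable_score hε (fun j hj => (hX j hj).1) a le_rfl).norm (fun _ => norm_nonneg _)
    (by positivity) hmax
  -- the bias
  set R : Ω → ℝ := fun ω => (1 / (T₀ : ℝ)) * ∑ j ∈ Finset.Icc 1 T,
    w j * (L ^ 2 * (((j : ℝ) - t) / T) ^ 2) * ‖X j ω‖ ^ 2 with hR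
  have hX2 : ∀ j ∈ Finset.Icc 1 T, Integrable
      (fun ω => w j * (L ^ 2 * (((j : ℝ) - t) / T) ^ 2) * ‖X j ω‖ ^ 2) μ := fun j hj =>
    ((hX j hj).1.integrable_norm_pow two_ne_zero).const_mul _
  have hRint : Integrable R μ := (integrable_finsetSum _ hX2).const_mul _
  have hR0 : ∀ ω, 0 ≤ R ω := fun ω => mul_nonneg (by positivity)
    (Finset.sum_nonneg fun j hj => mul_nonneg (mul_nonneg (hw.nonneg j hj) (by positivity))
      (by positivity))
  have hRmean : ∫ ω, R ω ∂μ ≤ M * L ^ 2 * (C * ((T₀ : ℝ) / T) ^ 2) := by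
    rw [hR, integral_const_mul, integral_finsetSum _ hX2]
    refine le_trans ?_ (mul_le_mul_of_nonneg_left (hw.sum_mul_sq_le hT₀)
      (by positivity : 0 ≤ M * L ^ 2))
    rw [mul_left_comm]
    refine mul_le_mul_of_nonneg_left ?_ (by positivity)
    rw [Finset.mul_sum]
    refine Finset.sum_le_sum fun j hj => ?_
    rw [integral_const_mul]
    refine (mul_le_mul_of_nonneg_left (hX j hj).2
      (mul_nonneg (hw.nonneg j hj) (by positivity))).trans_eq ?_
    ring
  have hbias := measure_ge_le_of_integral_le (b := c * ((T₀ : ℝ) / T) / 8) hRint hR0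
    (by positivity) hRmean
  have hquot : M * L ^ 2 * (C * ((T₀ : ℝ) / T) ^ 2) / (c * ((T₀ : ℝ) / T) / 8) =
      8 * (M * L ^ 2 * C) / c * ((T₀ : ℝ) / T) := by
    field_simp
  rw [hquot] at hbias
  refine le_trans ?_ ((measure_union_le _ _).trans (add_le_add hnoise hbias))
  refine measure_mono_ae ?_
  filter_upwards [hβhat] with ω hω hbad
  by_contra hgood
  change ¬ (ω ∈ {ω | _ ≤ ‖score a X ε T ω‖} ∪ {ω | _ ≤ R ω}) at hgood
  rw [Set.mem_union, not_or] at hgood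
  have h1 : ‖score a X ε T ω‖ < Real.log p ^ 2 / 8 := not_le.1 hgood.1
  have h2 : R ω < c * ((T₀ : ℝ) / T) / 8 := not_le.1 hgood.2
  refine hbad (predictionError_le_of_isLasso (e := fun j => ε j ω)
    (r := fun j => X j ω ⬝ᵥ (β₀ j - β₀ t)) hw.nonneg (fun j hj => ?_) hlam hω ?_ ?_)
  · rw [hy j hj, dotProduct_sub]
    ring
  · have e : (1 / (T₀ : ℝ)) • ∑ j ∈ Finset.Icc 1 T, (w j * ε j ω) • X j ω =
        (1 / s) • score a X ε T ω := by
      rw [score, Finset.smul_sum, Finset.smul_sum]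
      refine Finset.sum_congr rfl fun j _ => ?_
      rw [smul_smul, smul_smul, ha, ← hss]
      congr 1
      field_simp
    rw [e, norm_smul, Real.norm_of_nonneg (by positivity), penaltyLevel]
    have h3 : 1 / s * ‖score a X ε T ω‖ ≤ 1 / s * (Real.log p ^ 2 / 8) := by gcongr
    have h4 : 1 / s * (Real.log p ^ 2 / 8) = Real.log p ^ 2 / s / 8 := by ring
    have h5 : 0 ≤ (T₀ : ℝ) / T := by positivity
    linarith
  · have h3 : (1 / (T₀ : ℝ)) * ∑ j ∈ Finset.Icc 1 T, w j * (X j ω ⬝ᵥ (β₀ j - β₀ t)) ^ 2 ≤ R ω := by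
      refine mul_le_mul_of_nonneg_left (Finset.sum_le_sum fun j hj => ?_) (by positivity)
      rw [mul_assoc]
      refine mul_le_mul_of_nonneg_left ?_ (hw.nonneg j hj)
      rw [← sq_abs]
      calc _ ≤ (‖X j ω‖ * (L * (|(j : ℝ) - (t : ℝ)| / (T : ℝ)))) ^ 2 := by
            refine pow_le_pow_left₀ (abs_nonneg _) ((abs_dotProduct_le _ _).trans ?_) 2
            exact mul_le_mul_of_nonneg_left (hβ₀ j hj) (norm_nonneg _)
        _ = _ := by
            rw [mul_pow, mul_pow, div_pow, div_pow, sq_abs]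
            ring
    have h4 : (T₀ : ℝ) / T ≤ penaltyLevel p T T₀ := by
      rw [penaltyLevel]
      have : 0 ≤ Real.log p ^ 2 / Real.sqrt T₀ := by positivity
      linarith
    have h5 : c * ((T₀ : ℝ) / T) ≤ penaltyLevel p T T₀ * l1Norm (β₀ t) := by
      rw [mul_comm]
      exact mul_le_mul h4 hβ₀c hc.le hlam
    linarith

/-- The exceptional probability of the noise bound vanishes as the dimension grows. -/
lemma tendsto_noise_bound (K : ℝ) :
    Tendsto (fun x : ℝ => (Real.log (2 * x) + K) / (Real.log x ^ 2 / 8)) atTop (𝓝 0) := by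
  have h1 : Tendsto (fun x : ℝ => 8 * (Real.log x)⁻¹ +
      8 * (Real.log 2 + K) * ((Real.log x)⁻¹ * (Real.log x)⁻¹)) atTop
      (𝓝 (8 * 0 + 8 * (Real.log 2 + K) * (0 * 0))) := by
    have h := tendsto_inv_atTop_zero.comp Real.tendsto_log_atTop
    exact (h.const_mul 8).add ((h.mul h).const_mul _)
  simp only [mul_zero, add_zero] at h1
  refine h1.congr' ?_
  filter_upwards [eventually_gt_atTop 1] with x hx
  have := (Real.log_pos hx).ne'
  rw [Real.log_mul two_ne_zero (by linarith)]
  field_simp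
  ring

end TVLasso

/-- Asymptotics along an arbitrary sequence of models indexed by `n`, with sample size `T n`,
number of predictors `p n`, effective window `T₀ n`, and target date `t n`. The exceptional
probability is an outer one, so no measurable selection of the minimizer is needed. -/
theorem theorem2
    {Ω : ℕ → Type*} [∀ n, MeasurableSpace (Ω n)]
    (μ : ∀ n, Measure (Ω n)) [∀ n, IsProbabilityMeasure (μ n)]
    (p T T₀ t : ℕ → ℕ)
    (hp : Tendsto p atTop atTop) (hT : Tendsto T atTop atTop)
    (hT₀ : ∀ n, 1 ≤ T₀ n)
    (hT₀T : Tendsto (fun n => (T₀ n : ℝ) / (T n : ℝ)) atTop (𝓝 0))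
    (ht : ∀ n, t n ∈ Finset.Icc 1 (T n))
    (w : ∀ _ : ℕ, ℕ → ℝ) (C : ℝ)
    (hw : ∀ n, TVLasso.IsLocalWeight (w n) (t n) (T n) (T₀ n) C)
    (X : ∀ n, ℕ → Ω n → Fin (p n) → ℝ) (ε y : ∀ n, ℕ → Ω n → ℝ)
    (hXm : ∀ n, ∀ j ∈ Finset.Icc 1 (T n), Measurable (X n j))
    (hεm : ∀ n, ∀ j ∈ Finset.Icc 1 (T n), Measurable (ε n j))
    -- the moments of the predictors (in sup norm, the weakest choice) are uniformly bounded
    (M : ℝ)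
    (hX : ∀ n, ∀ j ∈ Finset.Icc 1 (T n),
      MemLp (X n j) 2 (μ n) ∧ ∫ ω, ‖X n j ω‖ ^ 2 ∂(μ n) ≤ M)
    (σ : ℝ)
    (hε : ∀ n, TVLasso.IsHomoskedasticMDS (μ n) (X n) (ε n) (T n) σ)
    -- the true coefficients: Lipschitz in rescaled time, and not vanishing at date `t`
    (β₀ : ∀ n, ℕ → Fin (p n) → ℝ) (L : ℝ)
    (hβ₀ : ∀ n, ∀ j ∈ Finset.Icc 1 (T n),
      TVLasso.l1Norm (β₀ n j - β₀ n (t n)) ≤ L * (|(j : ℝ) - (t n : ℝ)| / (T n : ℝ)))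
    (c : ℝ) (hc : 0 < c)
    (hβ₀c : ∀ᶠ n in atTop, c ≤ TVLasso.l1Norm (β₀ n (t n)))
    (hy : ∀ n, ∀ j ∈ Finset.Icc 1 (T n), ∀ ω, y n j ω = X n j ω ⬝ᵥ β₀ n j + ε n j ω)
    (βhat : ∀ n, Ω n → Fin (p n) → ℝ)
    (hβhat : ∀ n, ∀ᵐ ω ∂(μ n),
      TVLasso.IsLasso (T n) (T₀ n) (w n) (fun j => y n j ω) (fun j => X n j ω)
        (TVLasso.penaltyLevel (p n) (T n) (T₀ n)) (βhat n ω)) :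
    Tendsto
      (fun n => μ n {ω | ¬ TVLasso.predictionError (T n) (T₀ n) (w n) (fun j => X n j ω)
            (β₀ n (t n)) (βhat n ω)
          ≤ 3 * TVLasso.penaltyLevel (p n) (T n) (T₀ n) * TVLasso.l1Norm (β₀ n (t n))})
      atTop (𝓝 0) := by
  have hlim : Tendsto (fun n =>
      ENNReal.ofReal ((Real.log (2 * (p n : ℝ)) + 4 * (σ ^ 2 * M) * C ^ 2) /
        (Real.log (p n) ^ 2 / 8)) +
      ENNReal.ofReal (8 * (M * L ^ 2 * C) / c * ((T₀ n : ℝ) / T n))) atTop (𝓝 0) := by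
    have h1 := (TVLasso.tendsto_noise_bound (4 * (σ ^ 2 * M) * C ^ 2)).comp
      (tendsto_natCast_atTop_atTop.comp hp)
    have h2 := hT₀T.const_mul (8 * (M * L ^ 2 * C) / c)
    simpa using (ENNReal.tendsto_ofReal h1).add (ENNReal.tendsto_ofReal h2)
  refine tendsto_of_tendsto_of_tendsto_of_le_of_le' tendsto_const_nhds hlim
    (Eventually.of_forall fun _ => zero_le) ?_
  filter_upwards [hp.eventually_ge_atTop 2, hβ₀c] with n hpn hcn
  exact TVLasso.measure_predictionError_gt_le hpn (hT₀ n) (ht n) (hw n) (hXm n) (hεm n) (hX n)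
    (hε n) (hβ₀ n) hc hcn (hy n) (hβhat n)
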